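/- Let $n,k$ be positive integers and let $S\subseteq\{0,1,\dots,k-1\}$ be nonempty, with $s=\min S$. Assume that $n\ge 2k-s$, and, if $S=\{0\}$, that $n\ge 2k+1$. Let $J_S(n,k)$ be the generalized Johnson graph: its vertices are the $k$-element subsets of $\{1,\dots,n\}$, and two vertices are adjacent if and only if the size of their intersection lies in $S$. In a graph $G$ whose vertices are coloured black or white, a black vertex $v$ with exactly one white neighbour $w$ may colour $w$ black. A set $B$ of vertices is a zero forcing set if, starting with exactly the vertices of $B$ black, all vertices can be coloured black by repeated application of this rule. Let $Z(G)$, $Z_t(G)$ and $Z_c(G)$ denote the minimum cardinality of, respectively, a zero forcing set of $G$, a zero forcing set $B$ such that the induced subgraph $G[B]$ has no isolated vertices, and a zero forcing set $B$ such that $G[B]$ is connected (with the value $\infty$ if no such set exists). Then $$Z(J_S(n,k))\le Z_t(J_S(n,k))\le Z_c(J_S(n,k))\le \binom{n}{k}-\binom{n-2(k-s)}{s}.$$ Moreover, if $S=\{s,s+1,\dots,k-1\}$, then $$Z(J_S(n,k))=Z_t(J_S(n,k))=Z_c(J_S(n,k))=\binom{n}{k}-\binom{n-2(k-s)}{s}.$$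 -/

import Mathlib

/-- The vertices of a graph that are black at the end of the zero forcing process started from the
black set `B`: initially the vertices of `B` are black, and a black vertex `v` all of whose
neighbours other than `w` are black colours its neighbour `w` black. -/
inductive EventuallyBlack {V : Type*} (G : SimpleGraph V) (B : Set V) : V → Prop
  | initial (v : V) (hv : v ∈ B) : EventuallyBlack G B v
  | force (v w : V) (hv : EventuallyBlack G B v) (hvw : G.Adj v w)
      (h : ∀ u, G.Adj v u → u ≠ w → EventuallyBlack G B u) : EventuallyBlack G B w

/-- `B` is a zero forcing set of `G`. -/
def IsZeroForcing {V : Type*} (G : SimpleGraph V) (B : Finset V) : Prop :=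
  ∀ v : V, EventuallyBlack G (B : Set V) v

/-- `B` is a total zero forcing set: the induced subgraph `G[B]` has no isolated vertices. -/
def IsTotalZeroForcing {V : Type*} (G : SimpleGraph V) (B : Finset V) : Prop :=
  IsZeroForcing G B ∧ ∀ v : (B : Set V), ¬ (G.induce (B : Set V)).IsIsolated v

/-- `B` is a connected zero forcing set: the induced subgraph `G[B]` is connected. -/
def IsConnectedZeroForcing {V : Type*} (G : SimpleGraph V) (B : Finset V) : Prop :=
  IsZeroForcing G B ∧ (G.induce (B : Set V)).Connected

/-- The least cardinality of a finite set with property `P`; it is `⊤` if there is no such set. -/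
noncomputable def minCard {V : Type*} (P : Finset V → Prop) : ℕ∞ :=
  ⨅ (B : Finset V) (_ : P B), (B.card : ℕ∞)

/-- The zero forcing number `Z(G)` of a finite graph. -/
noncomputable def zeroForcingNumber {V : Type*} (G : SimpleGraph V) : ℕ∞ :=
  minCard (IsZeroForcing G)

/-- The total zero forcing number `Z_t(G)` of a finite graph. -/
noncomputable def totalZeroForcingNumber {V : Type*} (G : SimpleGraph V) : ℕ∞ :=
  minCard (IsTotalZeroForcing G)

/-- The connected zero forcing number `Z_c(G)` of a finite graph. -/
noncomputable def connectedZeroForcingNumber {V : Type*} (G : SimpleGraph V) : ℕ∞ :=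
  minCard (IsConnectedZeroForcing G)

/-- The generalized Johnson graph `J_S(n,k)`: its vertices are the `k`-subsets of an `n`-set, and
two distinct vertices are adjacent if the size of their intersection is in `S`. (Distinctness is
automatic when `S ⊆ {0, …, k - 1}`.) -/
def generalizedJohnson (S : Finset ℕ) (n k : ℕ) :
    SimpleGraph {v : Finset (Fin n) // v.card = k} where
  Adj v w := v ≠ w ∧ (v.1 ∩ w.1).card ∈ S
  symm := ⟨fun v w h => ⟨h.1.symm, by rw [Finset.inter_comm]; exact h.2⟩⟩
  loopless := ⟨fun _ h => h.1 rfl⟩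

/-!
The zero forcing number of `J_S(n,k)` is controlled through `d = k - s`.

For the upper bound, take disjoint `d`-subsets `X` and `Y`, and let the white vertices be the
`k`-subsets containing `X` and avoiding `Y`, that is the sets `X ∪ T` with `T` an `s`-subset of the
remaining `n - 2 * d` points. The black vertex `Y ∪ T` meets `X ∪ T` in `s` points and every other
white vertex in fewer, so it forces `X ∪ T` (`isZeroForcing_of_mem_iff`). The black vertices are
connected already through pairs meeting in exactly `r` points for a suitable `r ∈ S`
(`exists_mem_forall_reflTransGen_interStep`). In most cases this holds because all `k`-subsets
through a point of `Y` are black: these are connected by exchanges of single elements, and every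
other vertex has a neighbour among them (`reflTransGen_interStep_of_forall_mem`). The exceptions are
the Kneser graph and the case `s = 1`, `n = 2 * k - 1`; there only one vertex is white, and walks can
be led around it.

A connected zero forcing set is total because all degrees are at least two, so that no single vertex
is a zero forcing set.

For the lower bound with `S = {s, …, k - 1}`, it is enough to find vectors with a bilinear pairing,
in a space of dimension `(n - 2 * d).choose s`, such that the pairing of `v` and `w` is nonzero
exactly when `v = w` or `v` and `w` are adjacent: the functionals belonging to the white vertices
are then linearly independent (`card_sub_le_of_isZeroForcing`). The condition on `v` and `w` is
`s ≤ #(v ∩ w)`, equivalently `#(v \ w) ≤ d`. As in the proof of Füredi's threshold version of the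
skew Bollobás theorem, coordinate subspaces are cut with a generic subspace of codimension `d` and
then projected generically to dimension `n - 2 * d`; `v` gives an `s`-dimensional subspace, `w` one of
codimension `s`, and they are transversal iff `#(v \ w) ≤ d`. The determinant on the quotient
by the second subspace, pulled back to an alternating `s`-form, detects this
(`exists_alternatingMap_ne_zero_iff_le_card_inter`), and the alternating
`s`-forms make up a space of the required dimension.
-/

/-! ### Linear maps in general position -/

/-- Finitely many subspaces of dimension at most `r` over an infinite field have a common linear map
to an `r`-dimensional space that is injective on each of them: while the ambient dimension exceeds
`r`, a line outside all of the subspaces can be factored out. -/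
theorem exists_linearMap_disjoint_ker {K ι : Type*} [Field K] [Infinite K] [Finite ι] (r D : ℕ) :
    ∀ {V : Type*} [AddCommGroup V] [Module K V] [FiniteDimensional K V],
      Module.finrank K V = D → ∀ C : ι → Submodule K V, (∀ i, Module.finrank K (C i) ≤ r) →
      ∃ p : V →ₗ[K] (Fin r → K), ∀ i, Disjoint (C i) (LinearMap.ker p) := by
  induction D with
  | zero =>
    intro V _ _ _ hV C hC
    have := Module.finrank_zero_iff.mp hV
    exact ⟨0, fun i => by simp [Subsingleton.elim (C i) ⊥]⟩
  | succ D ih =>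
    intro V _ _ _ hV C hC
    by_cases hr : D + 1 ≤ r
    · obtain ⟨f, hf⟩ := (finrank_le_iff_exists_linearMap (R := K) (M := V)
        (M' := Fin r → K)).mp (by simpa [hV] using hr)
      exact ⟨f, fun i => by simp [LinearMap.ker_eq_bot.mpr hf]⟩
    · obtain ⟨x, hx⟩ := Submodule.exists_forall_notMem_of_forall_ne_top C fun i hi => by
        have := hC i
        rw [hi, finrank_top] at this
        omega
      by_cases hι : IsEmpty ι
      · exact ⟨0, fun i => (hι.false i).elim⟩
      · obtain ⟨i₀⟩ := not_isEmpty_iff.mp hι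
        have hx0 : x ≠ 0 := fun h => hx i₀ (h ▸ zero_mem _)
        have hquot : Module.finrank K (V ⧸ Submodule.span K {x}) = D := by
          have := Submodule.finrank_quotient_add_finrank (Submodule.span K {x})
          rw [finrank_span_singleton hx0] at this
          omega
        obtain ⟨p, hp⟩ := ih hquot (fun i => (C i).map (Submodule.mkQ _)) fun i =>
          (Submodule.finrank_map_le _ _).trans (hC i)
        refine ⟨p ∘ₗ Submodule.mkQ _, fun i => Submodule.disjoint_def.mpr fun v hv hpv => ?_⟩
        have hv0 := Submodule.disjoint_def.mp (hp i) _ (Submodule.mem_map_of_mem hv) hpv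
        rw [Submodule.mkQ_apply, Submodule.Quotient.mk_eq_zero,
          Submodule.mem_span_singleton] at hv0
        obtain ⟨c, rfl⟩ := hv0
        by_cases hc : c = 0
        · simp [hc]
        · exact (hx i (((C i).smul_mem_iff hc).mp hv)).elim

theorem LinearMap.finrank_map_add_finrank_inf_ker {K V W : Type*} [Field K] [AddCommGroup V]
    [Module K V] [FiniteDimensional K V] [AddCommGroup W] [Module K W] (f : V →ₗ[K] W)
    (C : Submodule K V) :
    Module.finrank K (C.map f) + Module.finrank K ↥(C ⊓ LinearMap.ker f) = Module.finrank K C := by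
  have h := LinearMap.finrank_range_add_finrank_ker (f.domRestrict C)
  rwa [LinearMap.range_domRestrict, LinearMap.ker_domRestrict, ← Submodule.finrank_map_subtype_eq,
    Submodule.map_comap_subtype] at h

theorem LinearMap.finrank_map_eq_of_disjoint_ker {K V W : Type*} [Field K] [AddCommGroup V]
    [Module K V] [FiniteDimensional K V] [AddCommGroup W] [Module K W] (f : V →ₗ[K] W)
    (C : Submodule K V) (h : Disjoint C (LinearMap.ker f)) :
    Module.finrank K (C.map f) = Module.finrank K C := by
  rw [← f.finrank_map_add_finrank_inf_ker C, h.eq_bot, finrank_bot, add_zero]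

theorem Pi.finrank_spanSubset_coe {n : ℕ} (u : Finset (Fin n)) :
    Module.finrank ℚ (Pi.spanSubset ℚ (u : Set (Fin n))) = u.card := by
  simp

/-- If `p` is injective on all coordinate subspaces of dimension at most `d`, then the kernel of `p`
meets every larger coordinate subspace in codimension `d`. -/
theorem finrank_spanSubset_inf_ker {n d : ℕ} (p : (Fin n → ℚ) →ₗ[ℚ] (Fin d → ℚ))
    (hp : ∀ u : Finset (Fin n), u.card ≤ d → Disjoint (Pi.spanSubset ℚ (u : Set (Fin n)))
      (LinearMap.ker p)) (u : Finset (Fin n)) (hu : d ≤ u.card) :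
    Module.finrank ℚ ↥(Pi.spanSubset ℚ (u : Set (Fin n)) ⊓ LinearMap.ker p) = u.card - d := by
  obtain ⟨u', hu', hcard⟩ := Finset.exists_subset_card_eq hu
  have hmono : Pi.spanSubset ℚ (u' : Set (Fin n)) ≤ Pi.spanSubset ℚ (u : Set (Fin n)) := by
    intro x hx
    rw [Pi.mem_spanSubset_iff] at hx ⊢
    exact fun i hi => hx i fun h => hi (Finset.coe_subset.mpr hu' h)
  have hle : d ≤ Module.finrank ℚ ((Pi.spanSubset ℚ (u : Set (Fin n))).map p) := by
    calc d = Module.finrank ℚ ((Pi.spanSubset ℚ (u' : Set (Fin n))).map p) := by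
          rw [p.finrank_map_eq_of_disjoint_ker _ (hp u' hcard.le), Pi.finrank_spanSubset_coe, hcard]
      _ ≤ _ := Submodule.finrank_mono (Submodule.map_mono hmono)
  have hge : Module.finrank ℚ ((Pi.spanSubset ℚ (u : Set (Fin n))).map p) ≤ d := by
    simpa using Submodule.finrank_le ((Pi.spanSubset ℚ (u : Set (Fin n))).map p)
  have hsum := p.finrank_map_add_finrank_inf_ker (Pi.spanSubset ℚ (u : Set (Fin n)))
  rw [Pi.finrank_spanSubset_coe] at hsum
  omega

theorem finrank_alternatingMap_fin (m s : ℕ) :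
    Module.finrank ℚ ((Fin m → ℚ) [⋀^Fin s]→ₗ[ℚ] ℚ) = m.choose s := by
  rw [(exteriorPower.alternatingMapLinearEquiv (R := ℚ) (M := Fin m → ℚ) (N := ℚ)
    (n := s)).finrank_eq]
  change Module.finrank ℚ (Module.Dual ℚ (⋀[ℚ]^s (Fin m → ℚ))) = _
  rw [Subspace.dual_finrank_eq, exteriorPower.finrank_eq, Module.finrank_fin_fun]

/-- Pulling back the determinant along a linear map `g` detects whether `g` is injective on the
space spanned by the argument. -/
theorem detRowAlternating_compLinearMap_ne_zero_iff {V : Type*} [AddCommGroup V] [Module ℚ V]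
    {s : ℕ} (g : V →ₗ[ℚ] (Fin s → ℚ)) {C : Submodule ℚ V} (b : Module.Basis (Fin s) ℚ C) :
    (Matrix.detRowAlternating (R := ℚ)).compLinearMap g (fun i => (b i : V)) ≠ 0 ↔
      Disjoint C (LinearMap.ker g) := by
  have hrows : (Matrix.detRowAlternating (R := ℚ)).compLinearMap g (fun i => (b i : V)) ≠ 0 ↔
      LinearIndependent ℚ fun i => g.domRestrict C (b i) := by
    rw [← isUnit_iff_ne_zero]
    exact (Matrix.isUnit_iff_isUnit_det (Matrix.of fun i => g (b i : V))).symm.trans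
      Matrix.linearIndependent_rows_iff_isUnit.symm
  rw [hrows, ← LinearMap.injective_domRestrict_iff]
  refine ⟨fun h => ?_, fun h => b.linearIndependent.map' _ (LinearMap.ker_eq_bot.mpr h)⟩
  rw [← LinearMap.ker_eq_bot, LinearMap.ker_eq_bot']
  intro x hx
  have hsum : ∑ i, b.repr x i • g.domRestrict C (b i) = 0 := by
    rw [← hx]
    conv_rhs => rw [← b.sum_repr x]
    simp only [map_sum, map_smul]
  have := Fintype.linearIndependent_iff.mp h _ hsum
  exact b.repr.map_eq_zero_iff.mp (Finsupp.ext this)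

/-- The algebraic input to the lower bound: alternating forms `α w` and tuples `u v`, indexed by the
`k`-subsets of an `n`-set, such that `α w (u v)` vanishes exactly when `v` and `w` meet in fewer than
`s` points. With `d = k - s`, a generic subspace of codimension `d` cuts the coordinate spaces of `v`
and of the complement of `w` in dimensions `s` and `n - k - d`, and these cuts meet trivially
iff `v \ w` has at most `d` points. A generic projection to dimension `n - 2 * d` is injective on all
sums of such pairs, and there the two cuts have complementary dimensions. -/
theorem exists_alternatingMap_ne_zero_iff_le_card_inter (n k s : ℕ) (hsk : s ≤ k)
    (hn : 2 * k - s ≤ n) :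
    ∃ (α : {v : Finset (Fin n) // v.card = k} →
          (Fin (n - 2 * (k - s)) → ℚ) [⋀^Fin s]→ₗ[ℚ] ℚ)
      (u : {v : Finset (Fin n) // v.card = k} → Fin s → (Fin (n - 2 * (k - s)) → ℚ)),
      ∀ v w, α w (u v) ≠ 0 ↔ s ≤ (v.1 ∩ w.1).card := by
  set d := k - s with hd
  obtain ⟨p, hp'⟩ := exists_linearMap_disjoint_ker (K := ℚ) (V := Fin n → ℚ)
    (ι := {u : Finset (Fin n) // u.card ≤ d}) d n (by simp)
    (fun u => Pi.spanSubset ℚ (u.1 : Set (Fin n)))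
    (fun u => by rw [Pi.finrank_spanSubset_coe]; exact u.2)
  have hp : ∀ u : Finset (Fin n), u.card ≤ d → Disjoint (Pi.spanSubset ℚ (u : Set (Fin n)))
      (LinearMap.ker p) := fun u hu => hp' ⟨u, hu⟩
  let U (v : Finset (Fin n)) : Submodule ℚ (Fin n → ℚ) :=
    Pi.spanSubset ℚ (v : Set (Fin n)) ⊓ LinearMap.ker p
  have hU (v : Finset (Fin n)) (hv : v.card = k) : Module.finrank ℚ (U v) = s := by
    rw [finrank_spanSubset_inf_ker p hp v (by omega)]
    omega
  have hB (w : Finset (Fin n)) (hw : w.card = k) : Module.finrank ℚ (U wᶜ) = n - 2 * d - s := by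
    have : wᶜ.card = n - k := by rw [Finset.card_compl, Fintype.card_fin, hw]
    rw [finrank_spanSubset_inf_ker p hp wᶜ (by omega)]
    omega
  have hUB (v w : Finset (Fin n)) : U v ⊓ U wᶜ = U (v \ w) := by
    ext x
    simp only [U, Submodule.mem_inf, Pi.mem_spanSubset_iff, Finset.mem_coe, Finset.mem_compl,
      Finset.mem_sdiff, not_not, not_and_or]
    exact ⟨fun h => ⟨fun i hi => hi.elim (h.1.1 i) (h.2.1 i), h.1.2⟩,
      fun h => ⟨⟨fun i hi => h.1 i (Or.inl hi), h.2⟩, ⟨fun i hi => h.1 i (Or.inr hi), h.2⟩⟩⟩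
  have hdisj (v w : Finset (Fin n)) (hv : v.card = k) :
      Disjoint (U v) (U wᶜ) ↔ s ≤ (v ∩ w).card := by
    have hcard := Finset.card_sdiff_add_card_inter v w
    rw [disjoint_iff, hUB]
    refine ⟨fun h => ?_, fun h => (hp _ (by omega)).eq_bot⟩
    by_contra hlt
    have := finrank_spanSubset_inf_ker p hp (v \ w) (by omega)
    rw [show Pi.spanSubset ℚ ((v \ w : Finset (Fin n)) : Set (Fin n)) ⊓ LinearMap.ker p = ⊥ from h,
      finrank_bot] at this
    omega
  obtain ⟨q, hq⟩ := exists_linearMap_disjoint_ker (K := ℚ) (V := Fin n → ℚ)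
    (ι := {v : Finset (Fin n) // v.card = k} × {v : Finset (Fin n) // v.card = k})
    (n - 2 * d) n (by simp) (fun x => U x.1.1 ⊔ U x.2.1ᶜ) (fun x => by
      have := Submodule.finrank_add_le_finrank_add_finrank (U x.1.1) (U x.2.1ᶜ)
      rw [hU _ x.1.2, hB _ x.2.2] at this
      omega)
  have hf (w : {v : Finset (Fin n) // v.card = k}) :
      ∃ f : (Fin (n - 2 * d) → ℚ) →ₗ[ℚ] (Fin s → ℚ), LinearMap.ker f = (U w.1ᶜ).map q := by
    have h₁ := q.finrank_map_eq_of_disjoint_ker (U w.1ᶜ) ((hq (w, w)).mono_left le_sup_right)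
    have h₂ := Submodule.finrank_quotient_add_finrank ((U w.1ᶜ).map q)
    rw [hB _ w.2] at h₁
    rw [Module.finrank_fin_fun] at h₂
    let e := LinearEquiv.ofFinrankEq ((Fin (n - 2 * d) → ℚ) ⧸ (U w.1ᶜ).map q) (Fin s → ℚ)
      (by rw [Module.finrank_fin_fun]; omega)
    exact ⟨e.toLinearMap ∘ₗ Submodule.mkQ _, by rw [LinearEquiv.ker_comp, Submodule.ker_mkQ]⟩
  choose f hf using hf
  let b (v : {v : Finset (Fin n) // v.card = k}) : Module.Basis (Fin s) ℚ (U v.1) :=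
    Module.finBasisOfFinrankEq ℚ _ (hU v.1 v.2)
  refine ⟨fun w => Matrix.detRowAlternating.compLinearMap (f w), fun v i => q (b v i : Fin n → ℚ),
    fun v w => ?_⟩
  rw [← hdisj v.1 w.1 v.2]
  refine Iff.trans (detRowAlternating_compLinearMap_ne_zero_iff (f w ∘ₗ q) (b v)) ?_
  rw [LinearMap.ker_comp, hf, Submodule.disjoint_def, Submodule.disjoint_def]
  refine forall₂_congr fun x hx => imp_congr_left ⟨fun hxq => ?_, Submodule.mem_map_of_mem⟩
  -- `q` is injective on `U v ⊔ U wᶜ`, so `q x = q y` with `y ∈ U wᶜ` forces `x = y`.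
  obtain ⟨y, hy, hxy⟩ := hxq
  have := LinearMap.disjoint_ker_iff_injOn.mp (hq (v, w)) (Submodule.mem_sup_right hy)
    (Submodule.mem_sup_left hx) hxy
  exact this ▸ hy

/-! ### The lower bound -/

/-- If the pattern of a matrix `α w (u v)` follows a graph `G`, its nonzero entries being those on the
diagonal and at edges, then a relation between the `α w` that is supported off a zero forcing set is
trivial, because vanishing of the coefficients propagates along forces. -/
theorem card_sub_le_of_isZeroForcing {V : Type*} [Fintype V] {G : SimpleGraph V} {m s : ℕ}
    (α : V → (Fin m → ℚ) [⋀^Fin s]→ₗ[ℚ] ℚ) (u : V → Fin s → (Fin m → ℚ))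
    (h : ∀ v w, α w (u v) ≠ 0 ↔ v = w ∨ G.Adj v w) {B : Finset V} (hB : IsZeroForcing G B) :
    Fintype.card V - B.card ≤ m.choose s := by
  classical
  have hli : LinearIndependent ℚ fun w : {w // w ∈ Bᶜ} => α w := by
    rw [Fintype.linearIndependent_iff]
    intro c hc
    let c' (v : V) : ℚ := if hv : v ∈ Bᶜ then c ⟨v, hv⟩ else 0
    have hc' : ∑ v, c' v • α v = 0 := by
      rw [← hc, ← Finset.sum_subset (Finset.subset_univ Bᶜ) fun v _ hv => by
          rw [show c' v = 0 from dif_neg hv, zero_smul],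
        ← Finset.sum_coe_sort]
      exact Finset.sum_congr rfl fun v _ => by simp only [c', dif_pos v.2]
    have key (v : V) (hv : EventuallyBlack G (B : Set V) v) : c' v = 0 := by
      induction hv with
      | initial v hv => exact dif_neg (by simpa using hv)
      | force v w _ hvw _ ihv ih =>
        have hsum : ∑ x, c' x * α x (u v) = 0 := by
          let ev : ((Fin m → ℚ) [⋀^Fin s]→ₗ[ℚ] ℚ) →ₗ[ℚ] ℚ :=
            { toFun := fun f => f (u v), map_add' := fun _ _ => rfl, map_smul' := fun _ _ => rfl }
          have := congrArg ev hc'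
          simp only [map_sum, map_smul, map_zero, smul_eq_mul] at this
          exact this
        rw [Finset.sum_eq_single w] at hsum
        · exact (mul_eq_zero.mp hsum).resolve_right ((h v w).mpr (Or.inr hvw))
        · intro x _ hxw
          by_cases hx : α x (u v) = 0
          · rw [hx, mul_zero]
          · rcases (h v x).mp hx with rfl | hx
            · rw [ihv, zero_mul]
            · rw [ih x hx hxw, zero_mul]
        · simp
    intro w
    simpa only [c', dif_pos w.2] using key w.1 (hB w.1)
  have : Module.Finite ℚ ((Fin m → ℚ) [⋀^Fin s]→ₗ[ℚ] ℚ) :=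
    Module.Finite.equiv (exteriorPower.alternatingMapLinearEquiv (R := ℚ)).symm
  have := hli.fintype_card_le_finrank
  rwa [finrank_alternatingMap_fin, Fintype.card_coe, Finset.card_compl] at this

/-! ### Walks between `k`-subsets -/

/-- A step between two `k`-subsets that satisfy `P` and meet in exactly `r` points. -/
def InterStep {α : Type*} [DecidableEq α] (r k : ℕ) (P : Finset α → Prop) (b c : Finset α) : Prop :=
  (P b ∧ b.card = k) ∧ (P c ∧ c.card = k) ∧ (b ∩ c).card = r

theorem InterStep.symm {α : Type*} [DecidableEq α] {r k : ℕ} {P : Finset α → Prop}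
    {b c : Finset α} (h : InterStep r k P b c) : InterStep r k P c b :=
  ⟨h.2.1, h.1, by rw [Finset.inter_comm]; exact h.2.2⟩

/-- To connect all `k`-subsets with a property `P` it suffices to connect those that differ by
exchanging one element, provided that one can move from any of them towards any other by an exchange
that preserves `P`. -/
theorem forall_of_exchange {α : Type*} [DecidableEq α] {k : ℕ} {P : Finset α → Prop}
    {R : Finset α → Finset α → Prop} (hrefl : ∀ b, R b b) (htrans : ∀ a b c, R a b → R b c → R a c)
    (hswap : ∀ (C : Finset α) (x y : α), x ∉ C → y ∉ C → x ≠ y → C.card + 1 = k →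
      P (insert x C) → P (insert y C) → R (insert x C) (insert y C))
    (hmove : ∀ b c : Finset α, b.card = k → c.card = k → P b → P c → 2 ≤ (b \ c).card →
      ∃ x ∈ b \ c, ∃ y ∈ c \ b, P (insert y (b.erase x)))
    (b c : Finset α) (hb : b.card = k) (hc : c.card = k) (hPb : P b) (hPc : P c) : R b c := by
  induction hj : (b \ c).card generalizing b with
  | zero =>
    have : b = c := Finset.eq_of_subset_of_card_le
      (Finset.sdiff_eq_empty_iff_subset.mp (Finset.card_eq_zero.mp hj)) (by omega)
    exact this ▸ hrefl b
  | succ j ih =>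
    obtain ⟨x, hx, y, hy, hP⟩ : ∃ x ∈ b \ c, ∃ y ∈ c \ b, P (insert y (b.erase x)) := by
      by_cases h2 : 2 ≤ (b \ c).card
      · exact hmove b c hb hc hPb hPc h2
      · obtain ⟨x, hx⟩ := Finset.card_eq_one.mp (show (b \ c).card = 1 by omega)
        have hcb : (c \ b).card = 1 := by
          have := Finset.card_sdiff_add_card_inter b c
          have := Finset.card_sdiff_add_card_inter c b
          rw [Finset.inter_comm] at this
          omega
        obtain ⟨y, hy⟩ := Finset.card_eq_one.mp hcb
        refine ⟨x, by simp [hx], y, by simp [hy], ?_⟩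
        have : insert y (b.erase x) = c := by
          ext z
          have h₁ := Finset.ext_iff.mp hx z
          have h₂ := Finset.ext_iff.mp hy z
          simp only [Finset.mem_sdiff, Finset.mem_singleton] at h₁ h₂
          simp only [Finset.mem_insert, Finset.mem_erase]
          tauto
        rwa [this]
    rw [Finset.mem_sdiff] at hx hy
    have hy' : y ∉ b.erase x := fun h => hy.2 (Finset.mem_of_mem_erase h)
    have hcard : (b.erase x).card + 1 = k := by rw [Finset.card_erase_add_one hx.1, hb]
    have hstep : R b (insert y (b.erase x)) := by
      have := hswap (b.erase x) x y (Finset.notMem_erase x b) hy' (fun h => hy.2 (h ▸ hx.1)) hcard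
        (by rwa [Finset.insert_erase hx.1]) hP
      rwa [Finset.insert_erase hx.1] at this
    refine htrans _ _ _ hstep (ih _ (by rw [Finset.card_insert_of_notMem hy', hcard]) hP ?_)
    have : insert y (b.erase x) \ c = (b \ c).erase x := by
      ext z
      simp only [Finset.mem_sdiff, Finset.mem_insert, Finset.mem_erase]
      constructor
      · rintro ⟨rfl | h, hz⟩
        · exact (hz hy.1).elim
        · exact ⟨h.1, h.2, hz⟩
      · rintro ⟨h₁, h₂, h₃⟩
        exact ⟨Or.inr ⟨h₁, h₂⟩, h₃⟩
    rw [this, Finset.card_erase_of_mem (Finset.mem_sdiff.mpr hx), hj]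
    omega

/-- The exchange walk between two sets of the same size can avoid any given set, since the first
exchange can be made by removing either of two elements. -/
theorem exists_exchange_ne {α : Type*} [DecidableEq α] (w b c : Finset α) (hbc : b.card = c.card)
    (h : 2 ≤ (b \ c).card) : ∃ x ∈ b \ c, ∃ y ∈ c \ b, insert y (b.erase x) ≠ w := by
  obtain ⟨x, hx, x', hx', hne⟩ := Finset.one_lt_card.mp h
  have hpos : 0 < (c \ b).card := by
    have := Finset.card_sdiff_comm hbc
    omega
  obtain ⟨y, hy⟩ := Finset.card_pos.mp hpos
  by_contra! hcon
  have h₁ := hcon x hx y hy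
  have h₂ := hcon x' hx' y hy
  have hmem : x' ∈ insert y (b.erase x) := Finset.mem_insert_of_mem
    (Finset.mem_erase.mpr ⟨hne.symm, (Finset.mem_sdiff.mp hx').1⟩)
  rw [h₁, ← h₂, Finset.mem_insert] at hmem
  rcases hmem with rfl | hmem
  · exact (Finset.mem_sdiff.mp hy).2 (Finset.mem_sdiff.mp hx').1
  · exact Finset.notMem_erase x' b hmem

/-- If `P` holds for all sets containing a fixed point `a`, then the `k`-subsets with property `P`
are connected: those containing `a` and differing by an exchange have a common neighbour containing
`a`, and every other one has a neighbour containing `a`. -/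
theorem reflTransGen_interStep_of_forall_mem {n k r : ℕ} {P : Finset (Fin n) → Prop} (a : Fin n)
    (hP : ∀ b, a ∈ b → P b) (hr : 1 ≤ r) (hrk : r < k) (hn : 2 * k - r ≤ n)
    (h : 2 ≤ r ∨ 2 * k ≤ n) (b c : Finset (Fin n)) (hb : b.card = k) (hc : c.card = k)
    (hPb : P b) (hPc : P c) : Relation.ReflTransGen (InterStep r k P) b c := by
  have : Std.Symm (InterStep r k P) := ⟨fun _ _ h => h.symm⟩
  have hsymm : ∀ b c, Relation.ReflTransGen (InterStep r k P) b c →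
      Relation.ReflTransGen (InterStep r k P) c b :=
    fun b c h => Relation.ReflTransGen.stdSymm.symm b c h
  have hstar : ∀ b c : Finset (Fin n), b.card = k → c.card = k → a ∈ b → a ∈ c →
      Relation.ReflTransGen (InterStep r k P) b c := by
    refine forall_of_exchange (fun _ => .refl) (fun _ _ _ => .trans) ?_ ?_
    · intro C x y hx hy hxy hC hax hay
      have haC : a ∈ C := by
        rcases Finset.mem_insert.mp hax with rfl | h
        · exact (Finset.mem_insert.mp hay).resolve_left hxy
        · exact h
      have hD : (insert x (insert y C))ᶜ.card = n - (k + 1) := by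
        rw [Finset.card_compl, Fintype.card_fin, Finset.card_insert_of_notMem (by simp [hxy, hx]),
          Finset.card_insert_of_notMem hy, hC]
      suffices ∃ e : Finset (Fin n), a ∈ e ∧ e.card = k ∧ (insert x C ∩ e).card = r ∧
          (insert y C ∩ e).card = r by
        obtain ⟨e, hae, he, h₁, h₂⟩ := this
        have hs₁ : InterStep r k P (insert x C) e :=
          ⟨⟨hP _ hax, by rw [Finset.card_insert_of_notMem hx, hC]⟩, ⟨hP _ hae, he⟩, h₁⟩
        have hs₂ : InterStep r k P (insert y C) e :=
          ⟨⟨hP _ hay, by rw [Finset.card_insert_of_notMem hy, hC]⟩, ⟨hP _ hae, he⟩, h₂⟩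
        exact (Relation.ReflTransGen.single hs₁).tail hs₂.symm
      by_cases hnk : 2 * k ≤ n
      · -- there is room for a common neighbour that contains neither `x` nor `y`
        obtain ⟨T, haT, hTC, hT⟩ := Finset.exists_subsuperset_card_eq (n := r)
          (Finset.singleton_subset_iff.mpr haC) (by simpa using hr) (by omega)
        obtain ⟨O, hO, hOc⟩ := Finset.exists_subset_card_eq
          (show k - r ≤ (insert x (insert y C))ᶜ.card by omega)
        have hO' : ∀ z ∈ O, z ≠ x ∧ z ≠ y ∧ z ∉ C := fun z hz => by simpa using hO hz
        have hdisj : Disjoint T O :=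
          Finset.disjoint_left.mpr fun z hzT hzO => (hO' z hzO).2.2 (hTC hzT)
        refine ⟨T ∪ O, Finset.mem_union_left _ (haT (Finset.mem_singleton_self a)), ?_, ?_, ?_⟩
        · rw [Finset.card_union_of_disjoint hdisj]
          omega
        · rw [← hT]
          congr 1
          grind
        · rw [← hT]
          congr 1
          grind
      · -- otherwise `r ≥ 2`, and the common neighbour is chosen to contain both `x` and `y`
        obtain ⟨T, haT, hTC, hT⟩ := Finset.exists_subsuperset_card_eq (n := r - 1)
          (Finset.singleton_subset_iff.mpr haC) (by rw [Finset.card_singleton]; omega) (by omega)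
        obtain ⟨O, hO, hOc⟩ := Finset.exists_subset_card_eq
          (show k - r - 1 ≤ (insert x (insert y C))ᶜ.card by omega)
        have hO' : ∀ z ∈ O, z ≠ x ∧ z ≠ y ∧ z ∉ C := fun z hz => by simpa using hO hz
        have hdisj : Disjoint T O :=
          Finset.disjoint_left.mpr fun z hzT hzO => (hO' z hzO).2.2 (hTC hzT)
        have hxT : x ∉ T := fun h => hx (hTC h)
        have hyT : y ∉ T := fun h => hy (hTC h)
        have hxO : x ∉ O := fun h => (hO' x h).1 rfl
        have hyO : y ∉ O := fun h => (hO' y h).2.1 rfl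
        have hcard : ∀ z, z ∉ T → (insert z T).card = r := fun z hz => by
          rw [Finset.card_insert_of_notMem hz]
          omega
        refine ⟨insert x (insert y (T ∪ O)), ?_, ?_, ?_, ?_⟩
        · simp [haT (Finset.mem_singleton_self a)]
        · rw [Finset.card_insert_of_notMem (by simp [hxy, hxT, hxO]),
            Finset.card_insert_of_notMem (by simp [hyT, hyO]), Finset.card_union_of_disjoint hdisj]
          omega
        · rw [← hcard x hxT]
          congr 1
          grind
        · rw [← hcard y hyT]
          congr 1
          grind
    · intro b c hb hc hab hac h2
      obtain ⟨x, hx⟩ := Finset.card_pos.mp (show 0 < (b \ c).card by omega)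
      obtain ⟨y, hy⟩ := Finset.card_pos.mp
        (show 0 < (c \ b).card by rw [← Finset.card_sdiff_comm (hb.trans hc.symm)]; omega)
      refine ⟨x, hx, y, hy, Finset.mem_insert_of_mem (Finset.mem_erase.mpr ⟨?_, hab⟩)⟩
      rintro rfl
      exact (Finset.mem_sdiff.mp hx).2 hac
  have hto : ∀ b : Finset (Fin n), b.card = k → P b →
      ∃ e : Finset (Fin n), a ∈ e ∧ e.card = k ∧
        Relation.ReflTransGen (InterStep r k P) b e := by
    intro b hb hPb
    by_cases hab : a ∈ b
    · exact ⟨b, hab, hb, .refl⟩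
    · obtain ⟨T, hTb, hT⟩ := Finset.exists_subset_card_eq (show r ≤ b.card by omega)
      have hbc : bᶜ.card = n - k := by rw [Finset.card_compl, Fintype.card_fin, hb]
      obtain ⟨O, haO, hO, hOc⟩ := Finset.exists_subsuperset_card_eq (s := {a}) (t := bᶜ)
        (n := k - r) (by simpa using hab) (by rw [Finset.card_singleton]; omega) (by omega)
      have hO' : ∀ z ∈ O, z ∉ b := fun z hz => by simpa using hO hz
      have hdisj : Disjoint T O := Finset.disjoint_left.mpr fun z hzT hzO => hO' z hzO (hTb hzT)
      have hae : a ∈ T ∪ O := Finset.mem_union_right _ (haO (Finset.mem_singleton_self a))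
      have hcard : (T ∪ O).card = k := by
        rw [Finset.card_union_of_disjoint hdisj]
        omega
      refine ⟨T ∪ O, hae, hcard, .single ⟨⟨hPb, hb⟩, ⟨hP _ hae, hcard⟩, ?_⟩⟩
      have hbO : Disjoint b O := Finset.disjoint_left.mpr fun z hzb hzO => hO' z hzO hzb
      rw [Finset.inter_union_distrib_left, Finset.inter_eq_right.mpr hTb,
        Finset.disjoint_iff_inter_eq_empty.mp hbO, Finset.union_empty, hT]
  obtain ⟨e, hae, he, hbe⟩ := hto b hb hPb
  obtain ⟨e', hae', he', hce⟩ := hto c hc hPc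
  exact (hbe.trans (hstar e e' he he' hae hae')).trans (hsymm _ _ hce)

/-- For `n ≥ 2 * k + 1`, the Kneser graph with one vertex `w` removed is connected. -/
theorem reflTransGen_interStep_zero_of_ne {n k : ℕ} {P : Finset (Fin n) → Prop}
    (w : Finset (Fin n)) (hw : w.card = k) (hP : ∀ b, b.card = k → (P b ↔ b ≠ w)) (hk : 1 ≤ k)
    (hn : 2 * k + 1 ≤ n) (b c : Finset (Fin n)) (hb : b.card = k) (hc : c.card = k)
    (hPb : P b) (hPc : P c) : Relation.ReflTransGen (InterStep 0 k P) b c := by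
  have hnbr : ∀ (C : Finset (Fin n)) (x y : Fin n), x ∉ C → y ∉ C → x ≠ y → C.card + 1 = k →
      P (insert x C) → P (insert y C) →
      (∃ e ⊆ (insert x (insert y C))ᶜ, e.card = k ∧ e ≠ w) →
      Relation.ReflTransGen (InterStep 0 k P) (insert x C) (insert y C) := by
    rintro C x y hx hy hxy hC hPx hPy ⟨e, he, hek, hew⟩
    have he' : ∀ z ∈ e, z ≠ x ∧ z ≠ y ∧ z ∉ C := fun z hz => by simpa using he hz
    have hs₁ : InterStep 0 k P (insert x C) e := by
      refine ⟨⟨hPx, by rw [Finset.card_insert_of_notMem hx, hC]⟩, ⟨(hP e hek).mpr hew, hek⟩, ?_⟩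
      rw [Finset.card_eq_zero]
      grind
    have hs₂ : InterStep 0 k P (insert y C) e := by
      refine ⟨⟨hPy, by rw [Finset.card_insert_of_notMem hy, hC]⟩, ⟨(hP e hek).mpr hew, hek⟩, ?_⟩
      rw [Finset.card_eq_zero]
      grind
    exact (Relation.ReflTransGen.single hs₁).tail hs₂.symm
  have hex : ∀ (C : Finset (Fin n)) (x y : Fin n), x ∉ C → y ∉ C → x ≠ y → C.card + 1 = k →
      ∃ e ⊆ (insert x (insert y C))ᶜ, e.card = k := by
    intro C x y hx hy hxy hC
    refine Finset.exists_subset_card_eq ?_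
    rw [Finset.card_compl, Fintype.card_fin, Finset.card_insert_of_notMem (by simp [hxy, hx]),
      Finset.card_insert_of_notMem hy, hC]
    omega
  refine forall_of_exchange (fun _ => .refl) (fun _ _ _ => .trans) ?_ ?_ b c hb hc hPb hPc
  · intro C x y hx hy hxy hC hPx hPy
    by_cases hgood : ∃ e ⊆ (insert x (insert y C))ᶜ, e.card = k ∧ e ≠ w
    · exact hnbr C x y hx hy hxy hC hPx hPy hgood
    · have hwD : w ⊆ (insert x (insert y C))ᶜ := by
        obtain ⟨e, he, hek⟩ := hex C x y hx hy hxy hC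
        by_cases hew : e = w
        · exact hew ▸ he
        · exact (hgood ⟨e, he, hek, hew⟩).elim
      have hwD' : ∀ z ∈ w, z ≠ x ∧ z ≠ y ∧ z ∉ C := fun z hz => by simpa using hwD hz
      rcases C.eq_empty_or_nonempty with rfl | ⟨z, hz⟩
      · refine .single ⟨⟨hPx, by simpa using hC⟩, ⟨hPy, by simpa using hC⟩, ?_⟩
        simp [hxy.symm]
      · -- Detour through `insert t C` for a point `t` of the removed set `w`: the common neighbours
        -- used on the way do not contain `t`.
        obtain ⟨t, ht⟩ := Finset.card_pos.mp (show 0 < w.card by omega)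
        obtain ⟨htx, hty, htC⟩ := hwD' t ht
        have hPt : P (insert t C) := by
          refine (hP _ (by rw [Finset.card_insert_of_notMem htC, hC])).mpr fun h => ?_
          exact (hwD' z (h ▸ Finset.mem_insert_of_mem hz)).2.2 hz
        have hne : ∀ e v, e ⊆ (insert v (insert t C))ᶜ → e ≠ w := by
          rintro e v he rfl
          have := he ht
          simp at this
        obtain ⟨e, he, hek⟩ := hex C x t hx htC htx.symm hC
        obtain ⟨e', he', hek'⟩ := hex C y t hy htC hty.symm hC
        refine (hnbr C x t hx htC htx.symm hC hPx hPt ⟨e, he, hek, hne e x he⟩).trans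
          (hnbr C t y htC hy hty hC hPt hPy ⟨e', ?_, hek', hne e' y he'⟩)
        rwa [Finset.insert_comm]
  · intro b c hb hc hPb hPc h2
    obtain ⟨x, hx, y, hy, hne⟩ := exists_exchange_ne w b c (hb.trans hc.symm) h2
    refine ⟨x, hx, y, hy, (hP _ ?_).mpr hne⟩
    rw [Finset.mem_sdiff] at hx hy
    rw [Finset.card_insert_of_notMem (fun h => hy.2 (Finset.mem_of_mem_erase h)),
      Finset.card_erase_add_one hx.1, hb]

/-- For `n = 2 * k - 1`, the graph of `k`-subsets meeting in exactly one point, with one vertex `w`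
removed, is connected. The sets `insert x C` and `insert y C` have the common neighbour `Cᶜ`. -/
theorem reflTransGen_interStep_one_of_ne {n k : ℕ} {P : Finset (Fin n) → Prop}
    (w : Finset (Fin n)) (hP : ∀ b, b.card = k → (P b ↔ b ≠ w)) (hk : 2 ≤ k)
    (hn : n = 2 * k - 1) (b c : Finset (Fin n)) (hb : b.card = k) (hc : c.card = k)
    (hPb : P b) (hPc : P c) : Relation.ReflTransGen (InterStep 1 k P) b c := by
  have hnbr : ∀ (C : Finset (Fin n)) (x y : Fin n), x ∉ C → y ∉ C → C.card + 1 = k →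
      P (insert x C) → P (insert y C) → Cᶜ ≠ w →
      Relation.ReflTransGen (InterStep 1 k P) (insert x C) (insert y C) := by
    intro C x y hx hy hC hPx hPy hCw
    have hCk : Cᶜ.card = k := by
      rw [Finset.card_compl, Fintype.card_fin]
      omega
    have hs : ∀ z, z ∉ C → P (insert z C) → InterStep 1 k P (insert z C) Cᶜ := by
      intro z hz hPz
      refine ⟨⟨hPz, by rw [Finset.card_insert_of_notMem hz, hC]⟩, ⟨(hP _ hCk).mpr hCw, hCk⟩, ?_⟩
      rw [Finset.card_eq_one]
      refine ⟨z, ?_⟩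
      ext t
      simp only [Finset.mem_inter, Finset.mem_insert, Finset.mem_compl, Finset.mem_singleton]
      grind
    exact (Relation.ReflTransGen.single (hs x hx hPx)).tail (hs y hy hPy).symm
  refine forall_of_exchange (fun _ => .refl) (fun _ _ _ => .trans) ?_ ?_ b c hb hc hPb hPc
  · intro C x y hx hy hxy hC hPx hPy
    by_cases hCw : Cᶜ = w
    · by_cases hk2 : k = 2
      · refine .single ⟨⟨hPx, by rw [Finset.card_insert_of_notMem hx, hC]⟩,
          ⟨hPy, by rw [Finset.card_insert_of_notMem hy, hC]⟩, ?_⟩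
        rw [show insert x C ∩ insert y C = C by grind]
        omega
      · -- Detour through the set obtained from `C` by exchanging a point `t` for `x` and `y`.
        obtain ⟨t, ht, t', ht', htt⟩ := Finset.one_lt_card.mp (show 1 < C.card by omega)
        have hxt : x ∉ C.erase t := fun h => hx (Finset.mem_of_mem_erase h)
        have hyt : y ∉ C.erase t := fun h => hy (Finset.mem_of_mem_erase h)
        have hcard : ∀ z, z ∉ C.erase t → (insert z (C.erase t)).card + 1 = k := fun z hz => by
          rw [Finset.card_insert_of_notMem hz, Finset.card_erase_add_one ht, hC]
        have hmid : P (insert y (insert x (C.erase t))) := by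
          refine (hP _ ?_).mpr ?_
          · rw [Finset.card_insert_of_notMem (by simp [hxy.symm, hyt]), hcard x hxt]
          · rintro rfl
            have : t' ∉ Cᶜ := by simpa using ht'
            exact this (hCw ▸ by simp [ht', htt.symm])
        have hcompl : ∀ z, z ∉ C → (insert z (C.erase t))ᶜ ≠ w := by
          intro z hz h
          rw [← hCw, compl_inj_iff] at h
          exact hz (h ▸ Finset.mem_insert_self z _)
        have htx : t ≠ x := fun h => hx (h ▸ ht)
        have hty : t ≠ y := fun h => hy (h ▸ ht)
        have e (z : Fin n) : insert t (insert z (C.erase t)) = insert z C := by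
          rw [Finset.insert_comm, Finset.insert_erase ht]
        have h₁ := hnbr (insert x (C.erase t)) t y (by simp [htx]) (by simp [hxy.symm, hyt])
          (hcard x hxt) (by rwa [e]) hmid (hcompl x hx)
        have h₂ := hnbr (insert y (C.erase t)) x t (by simp [hxy, hxt]) (by simp [hty])
          (hcard y hyt) (by rwa [Finset.insert_comm]) (by rwa [e]) (hcompl y hy)
        rw [e] at h₁ h₂
        rw [Finset.insert_comm] at h₂
        exact h₁.trans h₂
    · exact hnbr C x y hx hy hC hPx hPy hCw
  · intro b c hb hc hPb hPc h2
    obtain ⟨x, hx, y, hy, hne⟩ := exists_exchange_ne w b c (hb.trans hc.symm) h2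
    refine ⟨x, hx, y, hy, (hP _ ?_).mpr hne⟩
    rw [Finset.mem_sdiff] at hx hy
    rw [Finset.card_insert_of_notMem (fun h => hy.2 (Finset.mem_of_mem_erase h)),
      Finset.card_erase_add_one hx.1, hb]

/-! ### A connected forcing set -/

/-- The walks of `InterStep` with `r ∈ S` are walks in the induced subgraph of the generalized
Johnson graph on the vertices satisfying `P`. -/
theorem generalizedJohnson_induce_connected {n k r : ℕ} {S : Finset ℕ} (hrS : r ∈ S) (hrk : r < k)
    {P : Finset (Fin n) → Prop} {B : Finset {v : Finset (Fin n) // v.card = k}}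
    (hB : ∀ v, v ∈ B ↔ P v.1)
    (h : ∀ b c : Finset (Fin n), b.card = k → c.card = k → P b → P c →
      Relation.ReflTransGen (InterStep r k P) b c) (hne : B.Nonempty) :
    ((generalizedJohnson S n k).induce (B : Set {v : Finset (Fin n) // v.card = k})).Connected := by
  have hlift : ∀ (b : {v : Finset (Fin n) // v.card = k}) (hb : b ∈ B) (c : Finset (Fin n)),
      Relation.ReflTransGen (InterStep r k P) b.1 c → ∃ (hc : c.card = k) (hcB : ⟨c, hc⟩ ∈ B),
        ((generalizedJohnson S n k).induce (B : Set {v : Finset (Fin n) // v.card = k})).Reachable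
          ⟨b, hb⟩ ⟨⟨c, hc⟩, hcB⟩ := by
    intro b hb c hbc
    induction hbc with
    | refl => exact ⟨b.2, hb, .refl _⟩
    | tail _ hstep ih =>
      obtain ⟨hc, hcB, hreach⟩ := ih
      refine ⟨hstep.2.1.2, (hB _).mpr hstep.2.1.1, hreach.trans (SimpleGraph.Adj.reachable ?_)⟩
      refine ⟨fun heq => ?_, hstep.2.2.symm ▸ hrS⟩
      -- equal sets would meet in `k > r` points
      have hr := hstep.2.2
      rw [← Subtype.mk.inj heq, Finset.inter_self] at hr
      omega
  have : Nonempty (B : Set {v : Finset (Fin n) // v.card = k}) := hne.to_subtype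
  refine ⟨fun b c => ?_⟩
  obtain ⟨_, _, hreach⟩ := hlift b.1 b.2 c.1.1
    (h _ _ b.1.2 c.1.2 ((hB _).mp b.2) ((hB _).mp c.2))
  exact hreach

/-- If `X` and `Y` have size `k - s`, then the `k`-subsets other than those containing `X`
and avoiding `Y` form a zero forcing set: `X ∪ T` is forced by `Y ∪ T`, since no other
`X ∪ T'` with `#T' = s` meets `Y ∪ T` in `s` points. -/
theorem isZeroForcing_of_mem_iff {n k s : ℕ} {S : Finset ℕ} (hs : IsLeast (S : Set ℕ) s)
    (hsk : s < k) {X Y : Finset (Fin n)} (hX : X.card = k - s) (hY : Y.card = k - s)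
    {B : Finset {v : Finset (Fin n) // v.card = k}}
    (hB : ∀ v, v ∈ B ↔ ¬ (X ⊆ v.1 ∧ Disjoint Y v.1)) :
    IsZeroForcing (generalizedJohnson S n k) B := by
  intro w
  by_cases hw : w ∈ B
  · exact .initial w hw
  · obtain ⟨hXw, hYw⟩ : X ⊆ w.1 ∧ Disjoint Y w.1 := by
      by_contra h
      exact hw ((hB w).mpr h)
    have hT : (w.1 \ X).card = s := by
      rw [Finset.card_sdiff_of_subset hXw, w.2, hX]
      omega
    obtain ⟨y, hy⟩ := Finset.card_pos.mp (show 0 < Y.card by omega)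
    let v : {v : Finset (Fin n) // v.card = k} := ⟨Y ∪ (w.1 \ X), by
      rw [Finset.card_union_of_disjoint (hYw.mono_right Finset.sdiff_subset), hT, hY]
      omega⟩
    have hyv : y ∈ v.1 := Finset.mem_union_left _ hy
    have hvB : v ∈ B := (hB v).mpr fun h => Finset.disjoint_left.mp h.2 hy hyv
    have hvw : v.1 ∩ w.1 = w.1 \ X := by
      rw [Finset.union_inter_distrib_right, Finset.disjoint_iff_inter_eq_empty.mp hYw,
        Finset.empty_union, Finset.inter_eq_left.mpr Finset.sdiff_subset]
    refine .force v w (.initial v hvB) ⟨fun h => ?_, by rw [hvw, hT]; exact hs.1⟩ fun u hvu huw => ?_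
    · exact Finset.disjoint_left.mp hYw hy (h ▸ hyv)
    · refine .initial u ((hB u).mpr fun ⟨hXu, hYu⟩ => huw ?_)
      have hle : s ≤ (v.1 ∩ u.1).card := hs.2 hvu.2
      have hsub : v.1 ∩ u.1 ⊆ w.1 \ X := by
        rw [Finset.union_inter_distrib_right, Finset.disjoint_iff_inter_eq_empty.mp hYu,
          Finset.empty_union]
        exact Finset.inter_subset_left
      have heq := Finset.eq_of_subset_of_card_le hsub (by omega)
      refine (Subtype.ext (Finset.eq_of_subset_of_card_le (fun z hz => ?_) ?_)).symm
      · by_cases hzX : z ∈ X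
        · exact hXu hzX
        · exact (Finset.mem_inter.mp (heq ▸ Finset.mem_sdiff.mpr ⟨hz, hzX⟩)).2
      · rw [u.2, w.2]

theorem choose_le_card_filter_subset_disjoint {n k s : ℕ} (hsk : s ≤ k) {X Y : Finset (Fin n)}
    (hX : X.card = k - s) (hY : Y.card = k - s) (hXY : Disjoint X Y) :
    (n - 2 * (k - s)).choose s ≤ (Finset.univ.filter
      fun v : {v : Finset (Fin n) // v.card = k} => X ⊆ v.1 ∧ Disjoint Y v.1).card := by
  have hM : ((X ∪ Y)ᶜ).card = n - 2 * (k - s) := by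
    rw [Finset.card_compl, Fintype.card_fin, Finset.card_union_of_disjoint hXY, hX, hY]
    omega
  rw [← hM, ← Finset.card_powersetCard, ← Finset.card_map (Function.Embedding.subtype _)]
  refine Finset.card_le_card_of_injOn (fun T => X ∪ T) (fun T hT => ?_) fun T hT T' hT' h => ?_
  · obtain ⟨hTM, hTs⟩ := Finset.mem_powersetCard.mp hT
    have hTM' : ∀ z ∈ T, z ∉ X ∧ z ∉ Y := fun z hz => by simpa using hTM hz
    have hcard : (X ∪ T).card = k := by
      rw [Finset.card_union_of_disjoint (Finset.disjoint_right.mpr fun z hz => (hTM' z hz).1)]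
      omega
    refine Finset.mem_coe.mpr (Finset.mem_map.mpr ⟨⟨X ∪ T, hcard⟩, ?_, rfl⟩)
    refine Finset.mem_filter.mpr ⟨Finset.mem_univ _, Finset.subset_union_left, ?_⟩
    exact Finset.disjoint_union_right.mpr
      ⟨hXY.symm, Finset.disjoint_right.mpr fun z hz => (hTM' z hz).2⟩
  · have hrec : ∀ T ∈ Finset.powersetCard s (X ∪ Y)ᶜ, (X ∪ T) \ X = T := fun T hT => by
      refine Finset.union_sdiff_cancel_left (Finset.disjoint_right.mpr fun z hz => ?_)
      have := (Finset.mem_powersetCard.mp hT).1 hz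
      simp only [Finset.mem_compl, Finset.mem_union, not_or] at this
      exact this.1
    rw [← hrec T hT, ← hrec T' hT']
    exact congrArg (· \ X) h

/-- The connectivity of the complement of the sets containing `X` and avoiding `Y`. An `r ∈ S` is
chosen with room for the walks: `r = s` unless `s = 0` and `S ≠ {0}`, when a positive `r` serves. -/
theorem exists_mem_forall_reflTransGen_interStep {n k s : ℕ} {S : Finset ℕ}
    (hS : S ⊆ Finset.range k) (hs : IsLeast (S : Set ℕ) s) (hn : 2 * k - s ≤ n)
    (hKneser : S = {0} → 2 * k + 1 ≤ n) {X Y : Finset (Fin n)} (hX : X.card = k - s)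
    (hY : Y.card = k - s) (hXY : Disjoint X Y) :
    ∃ r ∈ S, ∀ b c : Finset (Fin n), b.card = k → c.card = k → ¬ (X ⊆ b ∧ Disjoint Y b) →
      ¬ (X ⊆ c ∧ Disjoint Y c) →
      Relation.ReflTransGen (InterStep r k fun b => ¬ (X ⊆ b ∧ Disjoint Y b)) b c := by
  have hlt : ∀ r ∈ S, r < k := fun r hr => Finset.mem_range.mp (hS hr)
  have hsk := hlt s hs.1
  obtain ⟨y, hy⟩ := Finset.card_pos.mp (show 0 < Y.card by omega)
  have hmem : ∀ b, y ∈ b → ¬ (X ⊆ b ∧ Disjoint Y b) :=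
    fun b hyb h => Finset.disjoint_left.mp h.2 hy hyb
  by_cases h0 : S = {0}
  · have hs0 : s = 0 := by simpa [h0] using hs.1
    subst hs0
    refine ⟨0, hs.1, reflTransGen_interStep_zero_of_ne X (by omega) (fun b hb => not_congr ?_) hsk
      (hKneser h0)⟩
    refine ⟨fun h => (Finset.eq_of_subset_of_card_le h.1 (by omega)).symm, ?_⟩
    rintro rfl
    exact ⟨Finset.Subset.refl _, hXY.symm⟩
  · by_cases hs1 : s = 1 ∧ n < 2 * k
    · obtain ⟨rfl, hnk⟩ := hs1
      refine ⟨1, hs.1, reflTransGen_interStep_one_of_ne Yᶜ (fun b hb => not_congr ?_) hsk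
        (by omega)⟩
      refine ⟨fun h => Finset.eq_of_subset_of_card_le
        (fun z hz => Finset.mem_compl.mpr fun hzY => Finset.disjoint_left.mp h.2 hzY hz) ?_, ?_⟩
      · rw [Finset.card_compl, Fintype.card_fin]
        omega
      · rintro rfl
        exact ⟨fun z hz => Finset.mem_compl.mpr (Finset.disjoint_left.mp hXY hz),
          disjoint_compl_right⟩
    · obtain ⟨r, hr, hr1, hrn, hr2⟩ : ∃ r ∈ S, 1 ≤ r ∧ 2 * k - r ≤ n ∧ (2 ≤ r ∨ 2 * k ≤ n) := by
        by_cases hs0 : s = 0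
        · obtain ⟨r, hr, hr0⟩ : ∃ r ∈ S, r ≠ 0 := by
            by_contra! hall
            exact h0 (Finset.eq_singleton_iff_unique_mem.mpr ⟨hs0 ▸ hs.1, hall⟩)
          exact ⟨r, hr, by omega, by omega, Or.inr (by omega)⟩
        · exact ⟨s, hs.1, by omega, hn, by omega⟩
      exact ⟨r, hr, reflTransGen_interStep_of_forall_mem y hmem hr1 (hlt r hr) hrn hr2⟩

theorem exists_isConnectedZeroForcing_card_le {n k s : ℕ} {S : Finset ℕ}
    (hS : S ⊆ Finset.range k) (hs : IsLeast (S : Set ℕ) s) (hn : 2 * k - s ≤ n)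
    (hKneser : S = {0} → 2 * k + 1 ≤ n) :
    ∃ B, IsConnectedZeroForcing (generalizedJohnson S n k) B ∧
      B.card ≤ n.choose k - (n - 2 * (k - s)).choose s := by
  have hsk : s < k := Finset.mem_range.mp (hS hs.1)
  obtain ⟨X, -, hX⟩ := Finset.exists_subset_card_eq (s := (Finset.univ : Finset (Fin n)))
    (n := k - s) (by rw [Finset.card_univ, Fintype.card_fin]; omega)
  obtain ⟨Y, hYX, hY⟩ := Finset.exists_subset_card_eq (s := Xᶜ) (n := k - s)
    (by rw [Finset.card_compl, Fintype.card_fin]; omega)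
  have hXY : Disjoint X Y :=
    Finset.disjoint_right.mpr fun z hz => Finset.mem_compl.mp (hYX hz)
  let B : Finset {v : Finset (Fin n) // v.card = k} :=
    Finset.univ.filter fun v => ¬ (X ⊆ v.1 ∧ Disjoint Y v.1)
  have hB : ∀ v, v ∈ B ↔ ¬ (X ⊆ v.1 ∧ Disjoint Y v.1) := fun v => by simp [B]
  obtain ⟨r, hr, hwalk⟩ := exists_mem_forall_reflTransGen_interStep hS hs hn hKneser hX hY hXY
  have hne : B.Nonempty := by
    obtain ⟨y, hy⟩ := Finset.card_pos.mp (show 0 < Y.card by omega)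
    obtain ⟨b, hYb, -, hb⟩ := Finset.exists_subsuperset_card_eq (n := k) (Finset.subset_univ Y)
      (by omega) (by rw [Finset.card_univ, Fintype.card_fin]; omega)
    exact ⟨⟨b, hb⟩, (hB _).mpr fun h => Finset.disjoint_left.mp h.2 hy (hYb hy)⟩
  refine ⟨B, ⟨isZeroForcing_of_mem_iff hs hsk hX hY hB,
    generalizedJohnson_induce_connected hr (Finset.mem_range.mp (hS hr))
      (P := fun b => ¬ (X ⊆ b ∧ Disjoint Y b)) hB hwalk hne⟩, ?_⟩
  have hsum := Finset.card_filter_add_card_filter_not (s := Finset.univ)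
    fun v : {v : Finset (Fin n) // v.card = k} => X ⊆ v.1 ∧ Disjoint Y v.1
  have hwhite := choose_le_card_filter_subset_disjoint hsk.le hX hY hXY
  rw [Finset.card_univ, Fintype.card_finset_len, Fintype.card_fin] at hsum
  change (Finset.univ.filter fun v : {v : Finset (Fin n) // v.card = k} =>
    ¬ (X ⊆ v.1 ∧ Disjoint Y v.1)).card ≤ _
  omega

/-! ### Connected forcing sets are total -/

/-- A single vertex forces nothing if all degrees are at least two. -/
theorem not_isZeroForcing_singleton {V : Type*} {G : SimpleGraph V}
    (h : ∀ v, ∃ u w, u ≠ w ∧ G.Adj v u ∧ G.Adj v w) (v : V) : ¬ IsZeroForcing G {v} := by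
  intro hv
  have key : ∀ x, EventuallyBlack G (({v} : Finset V) : Set V) x → x = v := by
    intro x hx
    induction hx with
    | initial x hx => simpa using hx
    | force x w _ _ _ ihx ih =>
      subst ihx
      obtain ⟨a, b, hab, ha, hb⟩ := h x
      by_cases haw : a = w
      · exact (hb.ne' (ih b hb (haw ▸ hab.symm))).elim
      · exact (ha.ne' (ih a ha haw)).elim
  obtain ⟨u, _, _, hu, _⟩ := h v
  exact hu.ne' (key u (hv u))

theorem generalizedJohnson_exists_two_adj {n k s : ℕ} {S : Finset ℕ}
    (hS : S ⊆ Finset.range k) (hs : IsLeast (S : Set ℕ) s) (hn : 2 * k - s ≤ n)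
    (hKneser : S = {0} → 2 * k + 1 ≤ n) (v : {v : Finset (Fin n) // v.card = k}) :
    ∃ u w, u ≠ w ∧ (generalizedJohnson S n k).Adj v u ∧ (generalizedJohnson S n k).Adj v w := by
  have hlt : ∀ r ∈ S, r < k := fun r hr => Finset.mem_range.mp (hS hr)
  have hvc : v.1ᶜ.card = n - k := by rw [Finset.card_compl, Fintype.card_fin, v.2]
  have hmk : ∀ r ∈ S, ∀ T O : Finset (Fin n), T ⊆ v.1 → O ⊆ v.1ᶜ → T.card = r → O.card = k - r →
      ∃ u : {v : Finset (Fin n) // v.card = k}, u.1 = T ∪ O ∧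
        (generalizedJohnson S n k).Adj v u := by
    intro r hr T O hT hO hTr hOr
    have hrk := hlt r hr
    have hvO : Disjoint v.1 O :=
      Finset.disjoint_right.mpr fun z hz => Finset.mem_compl.mp (hO hz)
    have hinter : v.1 ∩ (T ∪ O) = T := by
      rw [Finset.inter_union_distrib_left, Finset.inter_eq_right.mpr hT,
        Finset.disjoint_iff_inter_eq_empty.mp hvO, Finset.union_empty]
    have hcard : (T ∪ O).card = k := by
      rw [Finset.card_union_of_disjoint (hvO.mono_left hT)]
      omega
    refine ⟨⟨T ∪ O, hcard⟩, rfl, fun h => ?_, ?_⟩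
    · have := congrArg Finset.card hinter
      rw [← show v.1 = T ∪ O from congrArg Subtype.val h, Finset.inter_self, v.2] at this
      omega
    · change (v.1 ∩ (T ∪ O)).card ∈ S
      rwa [hinter, hTr]
  by_cases h0 : S = {0}
  · have hn' := hKneser h0
    have h0S : 0 ∈ S := by simp [h0]
    have hk := hlt 0 h0S
    obtain ⟨p, hp⟩ := Finset.card_pos.mp (show 0 < v.1ᶜ.card by omega)
    obtain ⟨O, hpO, hO, hOk⟩ := Finset.exists_subsuperset_card_eq (n := k)
      (Finset.singleton_subset_iff.mpr hp) (by rw [Finset.card_singleton]; omega) (by omega)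
    obtain ⟨O', hO', hOk'⟩ := Finset.exists_subset_card_eq (s := v.1ᶜ.erase p) (n := k)
      (by rw [Finset.card_erase_of_mem hp]; omega)
    obtain ⟨u, hu, hadj⟩ := hmk 0 h0S ∅ O (Finset.empty_subset _) hO rfl hOk
    obtain ⟨u', hu', hadj'⟩ := hmk 0 h0S ∅ O' (Finset.empty_subset _)
      (hO'.trans (Finset.erase_subset _ _)) rfl hOk'
    refine ⟨u, u', fun h => ?_, hadj, hadj'⟩
    have hpu : p ∈ u'.1 := by
      rw [← h, hu, Finset.empty_union]
      exact hpO (Finset.mem_singleton_self p)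
    rw [hu', Finset.empty_union] at hpu
    exact Finset.notMem_erase p _ (hO' hpu)
  · obtain ⟨r, hr, hr1, hrn⟩ : ∃ r ∈ S, 1 ≤ r ∧ 2 * k - r ≤ n := by
      by_cases hs0 : s = 0
      · obtain ⟨r, hr, hr0⟩ : ∃ r ∈ S, r ≠ 0 := by
          by_contra! hall
          exact h0 (Finset.eq_singleton_iff_unique_mem.mpr ⟨hs0 ▸ hs.1, hall⟩)
        exact ⟨r, hr, by omega, by omega⟩
      · exact ⟨s, hs.1, by omega, hn⟩
    have hrk := hlt r hr
    have hvk := v.2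
    obtain ⟨p, hp⟩ := Finset.card_pos.mp (show 0 < v.1.card by omega)
    obtain ⟨T, hpT, hT, hTr⟩ := Finset.exists_subsuperset_card_eq (n := r)
      (Finset.singleton_subset_iff.mpr hp) (by rw [Finset.card_singleton]; omega) (by omega)
    obtain ⟨T', hT', hTr'⟩ := Finset.exists_subset_card_eq (s := v.1.erase p) (n := r)
      (by rw [Finset.card_erase_of_mem hp]; omega)
    obtain ⟨O, hO, hOk⟩ := Finset.exists_subset_card_eq (s := v.1ᶜ) (n := k - r) (by omega)
    obtain ⟨u, hu, hadj⟩ := hmk r hr T O hT hO hTr hOk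
    obtain ⟨u', hu', hadj'⟩ := hmk r hr T' O (hT'.trans (Finset.erase_subset _ _)) hO hTr' hOk
    refine ⟨u, u', fun h => ?_, hadj, hadj'⟩
    have hpu : p ∈ u'.1 := by
      rw [← h, hu]
      exact Finset.mem_union_left _ (hpT (Finset.mem_singleton_self p))
    rw [hu', Finset.mem_union] at hpu
    rcases hpu with hpu | hpu
    · exact Finset.notMem_erase p _ (hT' hpu)
    · exact Finset.mem_compl.mp (hO hpu) hp

theorem IsConnectedZeroForcing.isTotalZeroForcing {V : Type*} {G : SimpleGraph V}
    (h : ∀ v, ∃ u w, u ≠ w ∧ G.Adj v u ∧ G.Adj v w) {B : Finset V}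
    (hB : IsConnectedZeroForcing G B) : IsTotalZeroForcing G B := by
  refine ⟨hB.1, fun v => ?_⟩
  have : Nontrivial (B : Set V) := by
    by_contra hnt
    rw [not_nontrivial_iff_subsingleton] at hnt
    have hBv : B = {v.1} := Finset.eq_singleton_iff_unique_mem.mpr
      ⟨v.2, fun x hx => congrArg Subtype.val (Subsingleton.elim (⟨x, hx⟩ : (B : Set V)) v)⟩
    exact not_isZeroForcing_singleton h v.1 (hBv ▸ hB.1)
  exact hB.2.preconnected.not_isIsolated v

theorem minCard_mono {V : Type*} {P Q : Finset V → Prop} (h : ∀ B, P B → Q B) :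
    minCard Q ≤ minCard P :=
  le_iInf₂ fun B hB => iInf₂_le B (h B hB)

/-! ### The zero forcing numbers of generalized Johnson graphs -/

theorem choose_sub_choose_le_zeroForcingNumber (n k s : ℕ) (hsk : s < k) (hn : 2 * k - s ≤ n) :
    ((n.choose k - (n - 2 * (k - s)).choose s : ℕ) : ℕ∞) ≤
      zeroForcingNumber (generalizedJohnson (Finset.Ico s k) n k) := by
  refine le_iInf₂ fun B hB => Nat.cast_le.mpr ?_
  obtain ⟨α, u, hαu⟩ := exists_alternatingMap_ne_zero_iff_le_card_inter n k s hsk.le hn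
  have := card_sub_le_of_isZeroForcing α u (fun v w => ?_) hB
  · rw [Fintype.card_finset_len, Fintype.card_fin] at this
    omega
  · rw [hαu]
    constructor
    · intro hle
      by_cases hvw : v = w
      · exact Or.inl hvw
      · refine Or.inr ⟨hvw, Finset.mem_Ico.mpr ⟨hle, lt_of_not_ge fun hge => hvw ?_⟩⟩
        have h₁ := Finset.eq_of_subset_of_card_le (Finset.inter_subset_left (s₁ := v.1)
          (s₂ := w.1)) (v.2.le.trans hge)
        have h₂ := Finset.eq_of_subset_of_card_le (Finset.inter_subset_right (s₁ := v.1)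
          (s₂ := w.1)) (w.2.le.trans hge)
        exact Subtype.ext (h₁.symm.trans h₂)
    · rintro (rfl | hadj)
      · rw [Finset.inter_self, v.2]
        exact hsk.le
      · exact (Finset.mem_Ico.mp hadj.2).1

theorem mainTheorem3 (n k s : ℕ) (S : Finset ℕ) (hS : S ⊆ Finset.range k)
    (hs : IsLeast (S : Set ℕ) s) (hn : 2 * k - s ≤ n) (hKneser : S = {0} → 2 * k + 1 ≤ n) :
    (zeroForcingNumber (generalizedJohnson S n k)
        ≤ totalZeroForcingNumber (generalizedJohnson S n k) ∧
      totalZeroForcingNumber (generalizedJohnson S n k)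
        ≤ connectedZeroForcingNumber (generalizedJohnson S n k) ∧
      connectedZeroForcingNumber (generalizedJohnson S n k)
        ≤ ((n.choose k - (n - 2 * (k - s)).choose s : ℕ) : ℕ∞)) ∧
    (S = Finset.Ico s k →
      zeroForcingNumber (generalizedJohnson S n k)
        = ((n.choose k - (n - 2 * (k - s)).choose s : ℕ) : ℕ∞) ∧
      totalZeroForcingNumber (generalizedJohnson S n k)
        = ((n.choose k - (n - 2 * (k - s)).choose s : ℕ) : ℕ∞) ∧
      connectedZeroForcingNumber (generalizedJohnson S n k)
        = ((n.choose k - (n - 2 * (k - s)).choose s : ℕ) : ℕ∞)) := by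
  have h₁ : zeroForcingNumber (generalizedJohnson S n k) ≤
      totalZeroForcingNumber (generalizedJohnson S n k) := minCard_mono fun _ hB => hB.1
  have h₂ : totalZeroForcingNumber (generalizedJohnson S n k) ≤
      connectedZeroForcingNumber (generalizedJohnson S n k) := minCard_mono fun _ hB =>
    hB.isTotalZeroForcing (generalizedJohnson_exists_two_adj hS hs hn hKneser)
  have h₃ : connectedZeroForcingNumber (generalizedJohnson S n k) ≤
      ((n.choose k - (n - 2 * (k - s)).choose s : ℕ) : ℕ∞) := by
    obtain ⟨B, hB, hcard⟩ := exists_isConnectedZeroForcing_card_le hS hs hn hKneser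
    exact (iInf₂_le B hB).trans (Nat.cast_le.mpr hcard)
  refine ⟨⟨h₁, h₂, h₃⟩, fun hIco => ?_⟩
  have h₄ : ((n.choose k - (n - 2 * (k - s)).choose s : ℕ) : ℕ∞) ≤
      zeroForcingNumber (generalizedJohnson S n k) :=
    hIco ▸ choose_sub_choose_le_zeroForcingNumber n k s (Finset.mem_range.mp (hS hs.1)) hn
  exact ⟨((h₁.trans h₂).trans h₃).antisymm h₄, (h₂.trans h₃).antisymm (h₄.trans h₁),
    h₃.antisymm ((h₄.trans h₁).trans h₂)⟩
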